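/- Let $\mathbb{N}=\{1,2,3,\ldots\}$, let $\mathbb{Z}_n$ be the additive group of residue classes modulo $n$, and let $\varphi$ be Euler's totient function. For $u,v\in\mathbb{N}$ let $F(u,v)$ be the number of automorphisms of the group $\mathbb{Z}_u\times\mathbb{Z}_v$, and for $m,n,r,s\in\mathbb{N}$ let $N(m,n,r,s)$ be the number of subgroups of the group $\mathbb{Z}_m\times\mathbb{Z}_n\times\mathbb{Z}_r\times\mathbb{Z}_s$. Theorem. For all $m,n,r,s\in\mathbb{N}$, $$N(m,n,r,s)=\sum \varphi(x_3)\,\varphi(y_3)\,\varphi(z_3)\,\varphi(t_3)\,F(u,v),$$ where the sum is over the (finite) set of all tuples $$(x_1,\ldots,x_5,\,y_1,\ldots,y_5,\,z_1,\ldots,z_5,\,t_1,\ldots,t_5)\in\mathbb{N}^{20}$$ that satisfy the following ten conditions: (1) $x_1x_2x_3=m$; (2) $x_3x_4x_5=n$; (3) $y_1y_2y_3=\gcd(x_1,x_4)$; (4) $y_3y_4y_5=x_3\operatorname{lcm}(x_1,x_4)$; (5) $z_1z_2z_3=r$; (6) $z_3z_4z_5=s$; (7) $t_1t_2t_3=\gcd(z_1,z_4)$;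 (8) $t_3t_4t_5=z_3\operatorname{lcm}(z_1,z_4)$; (9) $\gcd(y_2,y_5)=\gcd(t_2,t_5)$; (10) $y_3\operatorname{lcm}(y_2,y_5)=t_3\operatorname{lcm}(t_2,t_5)$, and where, for each such tuple, $u$ denotes the common value in (9) and $v$ the common value in (10). -/

import Mathlib

/-- A quintuple `(c₁, c₂, c₃, c₄, c₅)` of natural numbers. -/
@[ext]
structure Quintuple where
  c1 : ℕ
  c2 : ℕ
  c3 : ℕ
  c4 : ℕ
  c5 : ℕ

/-- All five entries of the quintuple are positive. -/
def Quintuple.Pos (q : Quintuple) : Prop :=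
  0 < q.c1 ∧ 0 < q.c2 ∧ 0 < q.c3 ∧ 0 < q.c4 ∧ 0 < q.c5

/-- A 20-tuple `(x₁, …, x₅, y₁, …, y₅, z₁, …, z₅, t₁, …, t₅)`, grouped into four quintuples. -/
@[ext]
structure Tuple20 where
  x : Quintuple
  y : Quintuple
  z : Quintuple
  t : Quintuple

/-- The index set of the sum: 20-tuples of positive integers that satisfy the ten conditions. -/
def indexSet (m n r s : ℕ) : Set Tuple20 :=
  {q | (q.x.Pos ∧ q.y.Pos ∧ q.z.Pos ∧ q.t.Pos) ∧
    q.x.c1 * q.x.c2 * q.x.c3 = m ∧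
    q.x.c3 * q.x.c4 * q.x.c5 = n ∧
    q.y.c1 * q.y.c2 * q.y.c3 = Nat.gcd q.x.c1 q.x.c4 ∧
    q.y.c3 * q.y.c4 * q.y.c5 = q.x.c3 * Nat.lcm q.x.c1 q.x.c4 ∧
    q.z.c1 * q.z.c2 * q.z.c3 = r ∧
    q.z.c3 * q.z.c4 * q.z.c5 = s ∧
    q.t.c1 * q.t.c2 * q.t.c3 = Nat.gcd q.z.c1 q.z.c4 ∧
    q.t.c3 * q.t.c4 * q.t.c5 = q.z.c3 * Nat.lcm q.z.c1 q.z.c4 ∧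
    Nat.gcd q.y.c2 q.y.c5 = Nat.gcd q.t.c2 q.t.c5 ∧
    q.y.c3 * Nat.lcm q.y.c2 q.y.c5 = q.t.c3 * Nat.lcm q.t.c2 q.t.c5}

/-- `numSubgroups m n r s` is the number of subgroups of `ℤ_m × ℤ_n × ℤ_r × ℤ_s`
(for positive `m`, `n`, `r`, `s`, so that the group is finite). -/
noncomputable def numSubgroups (m n r s : ℕ) : ℕ :=
  Nat.card (AddSubgroup (ZMod m × ZMod n × ZMod r × ZMod s))

/-- `numAut u v` is the number of automorphisms of `ℤ_u × ℤ_v`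
(for positive `u`, `v`, so that the group is finite). -/
noncomputable def numAut (u v : ℕ) : ℕ :=
  Nat.card ((ZMod u × ZMod v) ≃+ (ZMod u × ZMod v))

/-! By Goursat's lemma a subgroup of `G × H` is the same as sections `A₀ ≤ A ≤ G`, `B₀ ≤ B ≤ H` with
an isomorphism `A/A₀ ≃ B/B₀`. For `G = ℤ_m × ℤ_n` and `H = ℤ_r × ℤ_s` every subquotient has rank at
most two, hence is `ℤ_u × ℤ_v` with `v` its exponent and `u` its order divided by `v`. So two
sections contribute `F(u,v)` if their invariants agree, which is (9) and (10), and nothing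
otherwise.

It remains to list the sections `K ≤ I` of `ℤ_m × ℤ_n` with their invariants. Goursat for cyclic
factors gives `I`: a section of a cyclic group is fixed by its orders, so `I` is a quintuple `x`
with one of `φ(x₃)` isomorphisms, and `I ≃ ℤ_a × ℤ_b` with `a = gcd(x₁,x₄)`, `b = x₃ lcm(x₁,x₄)`.
Goursat in `ℤ_a × ℤ_b` gives `K` as a quintuple `y` with one of `φ(y₃)` isomorphisms, and `I/K` has
invariants `gcd(y₂,y₅)` and `y₃ lcm(y₂,y₅)`. The tuples `z`, `t` do the same for `ℤ_r × ℤ_s`. -/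

/-! ### Finite abelian groups of rank at most two -/

/-- A faithful character of `⟨g⟩`, with `g` of order the exponent, extends to a character `χ` of
`G`. Its kernel meets `⟨g⟩` trivially, and its image is cyclic of order at most the exponent, so
counting shows that `ker χ` is a complement. -/
theorem CommGroup.exists_mulEquiv_prod_zpowers {G : Type*} [CommGroup G] [Finite G] :
    ∃ (C : Subgroup G) (g : G), orderOf g = Monoid.exponent G ∧
      Nonempty (C × Subgroup.zpowers g ≃* G) := by
  obtain ⟨g, hg⟩ := Monoid.exists_orderOf_eq_exponent
    (Monoid.ExponentExists.of_finite (G := G))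
  have : NeZero (Monoid.exponent G) := ⟨Monoid.exponent_ne_zero_of_finite⟩
  have hcard : Nat.card (Subgroup.zpowers g) = Nat.card (rootsOfUnity (Monoid.exponent G) ℂ) := by
    rw [Nat.card_zpowers, hg, HasEnoughRootsOfUnity.natCard_rootsOfUnity]
  let e : Subgroup.zpowers g ≃* rootsOfUnity (Monoid.exponent G) ℂ :=
    mulEquivOfCyclicCardEq hcard
  obtain ⟨χ, hχ⟩ := MonoidHom.domRestrict_surjective ℂ (Subgroup.zpowers g)
    ((rootsOfUnity (Monoid.exponent G) ℂ).subtype.comp e.toMonoidHom)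
  have hχ' : ∀ x : Subgroup.zpowers g, χ x = (e x : ℂˣ) := fun x => DFunLike.congr_fun hχ x
  let F : χ.ker × Subgroup.zpowers g →* G :=
    (χ.ker.subtype).coprod (Subgroup.zpowers g).subtype
  have hF : Function.Injective F := by
    rw [injective_iff_map_eq_one]
    rintro ⟨⟨c, hc⟩, x⟩ h
    have h1 : c * (x : G) = 1 := h
    have h2 := congrArg χ h1
    rw [map_mul, hχ', (MonoidHom.mem_ker).1 hc, one_mul, map_one] at h2
    have h3 : x = 1 := by simpa using h2
    subst h3
    simpa using h1
  have hr : Nat.card χ.range ≤ Monoid.exponent G := by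
    have : Finite χ.range := Finite.of_surjective _ χ.rangeRestrict_surjective
    have hc : IsCyclic χ.range := inferInstance
    rw [← hc.exponent_eq_card]
    refine Nat.le_of_dvd (NeZero.pos _) ?_
    exact MonoidHom.exponent_dvd (f := χ.rangeRestrict) χ.rangeRestrict_surjective
  have hle : Nat.card G ≤ Nat.card (χ.ker × Subgroup.zpowers g) := by
    rw [Nat.card_prod, Nat.card_zpowers, hg, ← χ.ker.card_mul_index, Subgroup.index_ker]
    exact Nat.mul_le_mul_left _ hr
  have hb : Function.Bijective F := by
    rw [Nat.bijective_iff_injective_and_card]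
    exact ⟨hF, le_antisymm (Nat.card_le_card_of_injective F hF) hle⟩
  exact ⟨χ.ker, g, hg, ⟨MulEquiv.ofBijective F hb⟩⟩

theorem IsAddCyclic.card_nsmul_eq_zero {G : Type*} [AddCommGroup G] [Finite G] [IsAddCyclic G]
    {n : ℕ} (hn : n ∣ Nat.card G) : Nat.card {x : G // n • x = 0} = n := by
  have := IsAddCyclic.card_nsmulAddMonoidHom_ker (G := G) n
  rw [Nat.gcd_eq_right hn] at this
  exact this

/-- For every positive `n`, at most `n ^ 2` elements are killed by `n`. -/
def TorsionLeSq (G : Type*) [AddCommGroup G] : Prop :=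
  ∀ n : ℕ, 0 < n → Nat.card {x : G // n • x = 0} ≤ n ^ 2

theorem IsAddCyclic.of_card_nsmul_eq_zero_le {G : Type*} [AddCommGroup G] [Finite G]
    (h : ∀ n : ℕ, 0 < n → Nat.card {x : G // n • x = 0} ≤ n) : IsAddCyclic G := by
  classical
  have := Fintype.ofFinite G
  refine isAddCyclic_of_card_nsmul_eq_zero_le fun n hn => ?_
  have := h n hn
  rwa [Nat.card_eq_fintype_card, Fintype.card_subtype] at this

/-- The first invariant of a finite abelian group of rank at most two. -/
noncomputable def cofactor (G : Type*) [AddCommGroup G] : ℕ :=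
  Nat.card G / AddMonoid.exponent G

/-- Split off a cyclic factor of order the exponent. For `n` dividing the exponent it uses up `n` of
the at most `n ^ 2` elements killed by `n`, leaving at most `n` for the complement, which is
therefore cyclic. -/
theorem TorsionLeSq.nonempty_addEquiv {G : Type*} [AddCommGroup G] [Finite G]
    (h : TorsionLeSq G) :
    Nonempty (G ≃+ ZMod (cofactor G) × ZMod (AddMonoid.exponent G)) := by
  obtain ⟨C, g, hg, ⟨e⟩⟩ := CommGroup.exists_mulEquiv_prod_zpowers (G := Multiplicative G)
  have hexp : Monoid.exponent (Multiplicative G) = AddMonoid.exponent G :=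
    Monoid.exponent_multiplicative
  have hpos : 0 < AddMonoid.exponent G :=
    Nat.pos_of_ne_zero AddMonoid.exponent_ne_zero_of_finite
  rw [hexp] at hg
  let e' : Additive C × Additive (Subgroup.zpowers g) ≃+ G :=
    (AddEquiv.prodAdditive C (Subgroup.zpowers g)).symm.trans
      ((MulEquiv.toAdditive e).trans (AddEquiv.additiveMultiplicative G))
  have hD : Nat.card (Additive (Subgroup.zpowers g)) = AddMonoid.exponent G := by
    rw [← hg]; exact Nat.card_zpowers g
  have hDc : IsAddCyclic (Additive (Subgroup.zpowers g)) := inferInstance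
  have hC : Nat.card (Additive C) = cofactor G := by
    have := Nat.card_congr e'.toEquiv
    rw [Nat.card_prod, hD] at this
    rw [cofactor, ← this, Nat.mul_div_cancel _ hpos]
  have hCk : ∀ x : Additive C, AddMonoid.exponent G • x = 0 := by
    intro x
    have h0 : AddMonoid.exponent G • e' (x, 0) = 0 := AddMonoid.exponent_nsmul_eq_zero _
    rw [← map_nsmul, map_eq_zero_iff e' e'.injective] at h0
    exact congrArg Prod.fst h0
  have key : ∀ n : ℕ, 0 < n → n ∣ AddMonoid.exponent G →
      Nat.card {x : Additive C // n • x = 0} ≤ n := by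
    intro n hn hd
    have h1 : Nat.card ({x : Additive C // n • x = 0} ×
        {x : Additive (Subgroup.zpowers g) // n • x = 0}) ≤ Nat.card {x : G // n • x = 0} := by
      refine Nat.card_le_card_of_injective
        (fun p => ⟨e' (p.1.1, p.2.1), ?_⟩) ?_
      · rw [← map_nsmul, Prod.smul_mk, p.1.2, p.2.2]
        exact map_zero e'
      · rintro ⟨⟨a, ha⟩, ⟨b, hb⟩⟩ ⟨⟨c, hc⟩, ⟨d, hd⟩⟩ hh
        simpa using hh
    rw [Nat.card_prod, IsAddCyclic.card_nsmul_eq_zero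
      (G := Additive (Subgroup.zpowers g)) (hD.symm ▸ hd)] at h1
    have h2 := h1.trans (h n hn)
    rw [sq] at h2
    exact Nat.le_of_mul_le_mul_right h2 hn
  have hCc : IsAddCyclic (Additive C) := by
    refine IsAddCyclic.of_card_nsmul_eq_zero_le fun n hn => ?_
    -- The exponent kills the complement, so whatever `n` kills there is killed by its gcd with the
    -- exponent.
    refine le_trans ?_ ((key (Nat.gcd n (AddMonoid.exponent G)) (Nat.gcd_pos_of_pos_left _ hn)
      (Nat.gcd_dvd_right _ _)).trans (Nat.le_of_dvd hn (Nat.gcd_dvd_left _ _)))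
    refine Nat.card_le_card_of_injective (fun x => ⟨x.1, ?_⟩) ?_
    · rw [← addOrderOf_dvd_iff_nsmul_eq_zero]
      exact Nat.dvd_gcd (addOrderOf_dvd_iff_nsmul_eq_zero.2 x.2)
        (addOrderOf_dvd_iff_nsmul_eq_zero.2 (hCk _))
    · intro x y hxy
      exact Subtype.ext (by simpa using hxy)
  rw [← hD, ← hC]
  exact ⟨e'.symm.trans (AddEquiv.prodCongr (zmodAddCyclicAddEquiv hCc).symm
    (zmodAddCyclicAddEquiv hDc).symm)⟩

theorem TorsionLeSq.of_injective {G H : Type*} [AddCommGroup G] [AddCommGroup H] [Finite H]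
    (h : TorsionLeSq H) (f : G →+ H) (hf : Function.Injective f) : TorsionLeSq G := by
  intro n hn
  refine le_trans (Nat.card_le_card_of_injective
    (fun x : {x : G // n • x = 0} => (⟨f x.1, ?_⟩ : {x : H // n • x = 0})) ?_) (h n hn)
  · rw [← map_nsmul, x.2, map_zero]
  · intro x y hxy
    exact Subtype.ext (hf (by simpa using hxy))

/-- Kernel and image of multiplication by `n` have complementary orders. Unlike torsion, the index
of `nG` is easily compared under surjections. -/
theorem card_nsmul_eq_zero_eq_index {G : Type*} [AddCommGroup G] [Finite G] (n : ℕ) :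
    Nat.card {x : G // n • x = 0} = (nsmulAddMonoidHom (α := G) n).range.index := by
  have h1 := (nsmulAddMonoidHom (α := G) n).ker.card_mul_index
  have h2 := (nsmulAddMonoidHom (α := G) n).range.card_mul_index
  rw [AddSubgroup.index_ker, ← h2, mul_comm] at h1
  exact Nat.eq_of_mul_eq_mul_left Nat.card_pos h1

theorem TorsionLeSq.of_surjective {G H : Type*} [AddCommGroup G] [AddCommGroup H] [Finite G]
    (h : TorsionLeSq G) (f : G →+ H) (hf : Function.Surjective f) : TorsionLeSq H := by
  have : Finite H := Finite.of_surjective f hf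
  intro n hn
  refine le_trans ?_ (h n hn)
  rw [card_nsmul_eq_zero_eq_index, card_nsmul_eq_zero_eq_index,
    ← AddSubgroup.index_comap_of_surjective _ hf]
  refine Nat.le_of_dvd (Nat.pos_of_ne_zero AddSubgroup.index_ne_zero_of_finite)
    (AddSubgroup.index_dvd_of_le ?_)
  rintro _ ⟨x, rfl⟩
  exact ⟨f x, (map_nsmul f n x).symm⟩

theorem TorsionLeSq.prod {G H : Type*} [AddCommGroup G] [AddCommGroup H] [Finite G] [Finite H]
    [IsAddCyclic G] [IsAddCyclic H] : TorsionLeSq (G × H) := by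
  intro n hn
  have hle : ∀ (K : Type _) [AddCommGroup K] [Finite K] [IsAddCyclic K],
      Nat.card {x : K // n • x = 0} ≤ n := by
    intro K _ _ _
    have := IsAddCyclic.card_nsmulAddMonoidHom_ker (G := K) n
    exact this.trans_le (Nat.le_of_dvd hn (Nat.gcd_dvd_right _ _))
  have hle' : Nat.card {x : H // n • x = 0} ≤ n := by
    have := IsAddCyclic.card_nsmulAddMonoidHom_ker (G := H) n
    exact this.trans_le (Nat.le_of_dvd hn (Nat.gcd_dvd_right _ _))
  rw [sq]
  refine le_trans ?_ (Nat.mul_le_mul (hle G) hle')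
  rw [← Nat.card_prod]
  refine Nat.card_le_card_of_injective (fun x => (⟨x.1.1, congrArg Prod.fst x.2⟩,
    ⟨x.1.2, congrArg Prod.snd x.2⟩)) ?_
  rintro ⟨⟨a, b⟩, h⟩ ⟨⟨c, d⟩, h'⟩ hh
  simpa using hh

/-! ### Goursat's lemma and the invariants of Goursat subgroups -/

/-- Pairs of nested subgroups of `G`. -/
abbrev SubPair (G : Type*) [AddCommGroup G] := Σ A : AddSubgroup G, AddSubgroup A

/-- The subquotient attached to a pair of nested subgroups. -/
abbrev SubPair.Subquotient {G : Type*} [AddCommGroup G] (p : SubPair G) := p.1 ⧸ p.2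

section Goursat

variable {G H : Type*} [AddCommGroup G] [AddCommGroup H]

/-- Pairs in `p.1 × q.1` that are matched by an isomorphism of the subquotients. -/
def fiberProduct (p : SubPair G) (q : SubPair H) (e : p.Subquotient ≃+ q.Subquotient) :
    AddSubgroup (p.1 × q.1) :=
  e.toAddMonoidHom.graph.comap ((QuotientAddGroup.mk' p.2).prodMap (QuotientAddGroup.mk' q.2))

/-- The subgroup of `G × H` attached to Goursat data. -/
def goursatSubgroup (p : SubPair G) (q : SubPair H) (e : p.Subquotient ≃+ q.Subquotient) :
    AddSubgroup (G × H) :=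
  (fiberProduct p q e).map (p.1.subtype.prodMap q.1.subtype)

variable {p : SubPair G} {q : SubPair H} {e : p.Subquotient ≃+ q.Subquotient}

theorem mem_fiberProduct {x : p.1 × q.1} :
    x ∈ fiberProduct p q e ↔ e (QuotientAddGroup.mk x.1) = QuotientAddGroup.mk x.2 := by
  simp [fiberProduct, AddMonoidHom.mem_graph]

theorem mem_goursatSubgroup {x : G × H} :
    x ∈ goursatSubgroup p q e ↔ ∃ (ha : x.1 ∈ p.1) (hb : x.2 ∈ q.1),
      e (QuotientAddGroup.mk ⟨x.1, ha⟩) = QuotientAddGroup.mk ⟨x.2, hb⟩ := by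
  constructor
  · rintro ⟨⟨a, b⟩, h, rfl⟩
    exact ⟨a.2, b.2, mem_fiberProduct.1 h⟩
  · rintro ⟨ha, hb, h⟩
    exact ⟨(⟨x.1, ha⟩, ⟨x.2, hb⟩), mem_fiberProduct.2 h, rfl⟩

theorem exists_mem_goursatSubgroup_left (e : p.Subquotient ≃+ q.Subquotient) {g : G}
    (hg : g ∈ p.1) : ∃ h, (g, h) ∈ goursatSubgroup p q e := by
  obtain ⟨b, hb⟩ := QuotientAddGroup.mk_surjective (e (QuotientAddGroup.mk ⟨g, hg⟩))
  exact ⟨b, mem_goursatSubgroup.2 ⟨hg, b.2, hb.symm⟩⟩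

theorem exists_mem_goursatSubgroup_right (e : p.Subquotient ≃+ q.Subquotient) {h : H}
    (hh : h ∈ q.1) : ∃ g, (g, h) ∈ goursatSubgroup p q e := by
  obtain ⟨b, hb⟩ := QuotientAddGroup.mk_surjective (e.symm (QuotientAddGroup.mk ⟨h, hh⟩))
  exact ⟨b, mem_goursatSubgroup.2 ⟨b.2, hh, by simp [hb]⟩⟩

/-- Here and in the next three lemmas the sections are recovered from the subgroup: the large groups
as projections, the small ones as slices through zero. -/
theorem mem_left_iff_goursatSubgroup (e : p.Subquotient ≃+ q.Subquotient) {g : G} :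
    g ∈ p.1 ↔ ∃ h, (g, h) ∈ goursatSubgroup p q e :=
  ⟨exists_mem_goursatSubgroup_left e, fun ⟨_, h⟩ => (mem_goursatSubgroup.1 h).1⟩

theorem mem_right_iff_goursatSubgroup (e : p.Subquotient ≃+ q.Subquotient) {h : H} :
    h ∈ q.1 ↔ ∃ g, (g, h) ∈ goursatSubgroup p q e :=
  ⟨exists_mem_goursatSubgroup_right e, fun ⟨_, h⟩ => (mem_goursatSubgroup.1 h).2.1⟩

theorem mem_left_kernel_iff_goursatSubgroup (e : p.Subquotient ≃+ q.Subquotient) {a : p.1} :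
    a ∈ p.2 ↔ ((a : G), (0 : H)) ∈ goursatSubgroup p q e := by
  rw [mem_goursatSubgroup]
  have h0 : (QuotientAddGroup.mk (⟨0, q.1.zero_mem⟩ : q.1) : q.Subquotient) = 0 :=
    (QuotientAddGroup.eq_zero_iff _).2 q.2.zero_mem
  constructor
  · intro h
    refine ⟨a.2, q.1.zero_mem, ?_⟩
    rw [h0, (QuotientAddGroup.eq_zero_iff _).2 h, map_zero]
  · rintro ⟨_, _, h⟩
    rw [h0, map_eq_zero_iff e e.injective] at h
    exact (QuotientAddGroup.eq_zero_iff _).1 h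

theorem mem_right_kernel_iff_goursatSubgroup (e : p.Subquotient ≃+ q.Subquotient) {b : q.1} :
    b ∈ q.2 ↔ ((0 : G), (b : H)) ∈ goursatSubgroup p q e := by
  rw [mem_goursatSubgroup]
  have h0 : (QuotientAddGroup.mk (⟨0, p.1.zero_mem⟩ : p.1) : p.Subquotient) = 0 :=
    (QuotientAddGroup.eq_zero_iff _).2 p.2.zero_mem
  constructor
  · intro h
    refine ⟨p.1.zero_mem, b.2, ?_⟩
    rw [h0, map_zero, eq_comm]
    exact (QuotientAddGroup.eq_zero_iff _).2 h
  · rintro ⟨_, _, h⟩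
    rw [h0, map_zero, eq_comm] at h
    exact (QuotientAddGroup.eq_zero_iff _).1 h

theorem goursatSubgroup_bijective :
    Function.Bijective fun d : (Σ pq : SubPair G × SubPair H,
      (pq.1.Subquotient ≃+ pq.2.Subquotient)) => goursatSubgroup d.1.1 d.1.2 d.2 := by
  constructor
  · rintro ⟨⟨⟨A, A₀⟩, ⟨B, B₀⟩⟩, e⟩ ⟨⟨⟨A', A₀'⟩, ⟨B', B₀'⟩⟩, e'⟩ h
    replace h : goursatSubgroup ⟨A, A₀⟩ ⟨B, B₀⟩ e = goursatSubgroup ⟨A', A₀'⟩ ⟨B', B₀'⟩ e' := h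
    obtain rfl : A = A' := by
      ext g
      rw [mem_left_iff_goursatSubgroup e, mem_left_iff_goursatSubgroup e', h]
    obtain rfl : B = B' := by
      ext g
      rw [mem_right_iff_goursatSubgroup e, mem_right_iff_goursatSubgroup e', h]
    obtain rfl : A₀ = A₀' := by
      ext g
      rw [mem_left_kernel_iff_goursatSubgroup e, mem_left_kernel_iff_goursatSubgroup e', h]
    obtain rfl : B₀ = B₀' := by
      ext g
      rw [mem_right_kernel_iff_goursatSubgroup e, mem_right_kernel_iff_goursatSubgroup e', h]
    -- With equal sections, the subgroup determines the graph of the isomorphism.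
    obtain rfl : e = e' := by
      ext x
      obtain ⟨a, rfl⟩ := QuotientAddGroup.mk_surjective x
      obtain ⟨b, hb⟩ := QuotientAddGroup.mk_surjective (e a)
      have h1 : ((a : G), (b : H)) ∈ goursatSubgroup ⟨A, A₀⟩ ⟨B, B₀⟩ e :=
        mem_goursatSubgroup.2 ⟨a.2, b.2, hb.symm⟩
      rw [h] at h1
      obtain ⟨_, _, h2⟩ := mem_goursatSubgroup.1 h1
      exact hb.symm.trans h2.symm
    rfl
  · intro I
    obtain ⟨A, B, A₀, B₀, _, _, e, h⟩ := AddSubgroup.goursat (I := I)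
    exact ⟨⟨(⟨A, A₀⟩, ⟨B, B₀⟩), e⟩, h.symm⟩

/-- The fiber product is the kernel of the surjection `(a, b) ↦ e [a] - [b]` onto the second
subquotient. -/
theorem card_goursatSubgroup [Finite G] [Finite H] (e : p.Subquotient ≃+ q.Subquotient) :
    Nat.card (goursatSubgroup p q e) * Nat.card q.Subquotient = Nat.card p.1 * Nat.card q.1 := by
  have hinj : Function.Injective (p.1.subtype.prodMap q.1.subtype) := by
    rintro ⟨a, b⟩ ⟨c, d⟩ h
    simpa using h
  rw [← Nat.card_prod p.1 q.1, ← (fiberProduct p q e).card_mul_index]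
  congr 1
  · exact (Nat.card_congr ((fiberProduct p q e).equivMapOfInjective _ hinj).toEquiv).symm
  · let f : p.1 × q.1 →+ q.Subquotient :=
      (e.toAddMonoidHom.comp (QuotientAddGroup.mk' p.2)).comp (AddMonoidHom.fst _ _) -
        (QuotientAddGroup.mk' q.2).comp (AddMonoidHom.snd _ _)
    have hk : fiberProduct p q e = f.ker := by
      ext x
      rw [mem_fiberProduct, AddMonoidHom.mem_ker]
      exact sub_eq_zero.symm
    have hf : Function.Surjective f := by
      intro y
      obtain ⟨b, rfl⟩ := QuotientAddGroup.mk_surjective y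
      exact ⟨(0, -b), by simp [f]⟩
    rw [hk, AddSubgroup.index_ker, AddMonoidHom.range_eq_top.2 hf]
    exact (Nat.card_congr AddSubgroup.topEquiv.toEquiv).symm

/-- The subgroup lies in `p.1 × q.1` and projects onto both factors. -/
theorem exponent_goursatSubgroup (e : p.Subquotient ≃+ q.Subquotient) :
    AddMonoid.exponent (goursatSubgroup p q e) =
      Nat.lcm (AddMonoid.exponent p.1) (AddMonoid.exponent q.1) := by
  refine Nat.dvd_antisymm ?_ (Nat.lcm_dvd ?_ ?_)
  · rw [AddMonoid.exponent_dvd_iff_forall_nsmul_eq_zero]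
    rintro ⟨⟨g, h⟩, hx⟩
    obtain ⟨hg, hh, -⟩ := mem_goursatSubgroup.1 hx
    have h1 := AddMonoid.exponent_dvd_iff_forall_nsmul_eq_zero.1
      (Nat.dvd_lcm_left (AddMonoid.exponent p.1) (AddMonoid.exponent q.1)) ⟨g, hg⟩
    have h2 := AddMonoid.exponent_dvd_iff_forall_nsmul_eq_zero.1
      (Nat.dvd_lcm_right (AddMonoid.exponent p.1) (AddMonoid.exponent q.1)) ⟨h, hh⟩
    exact Subtype.ext (Prod.ext (congrArg Subtype.val h1) (congrArg Subtype.val h2))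
  · rw [AddMonoid.exponent_dvd_iff_forall_nsmul_eq_zero]
    rintro ⟨g, hg⟩
    obtain ⟨h, hx⟩ := exists_mem_goursatSubgroup_left e hg
    exact Subtype.ext (congrArg (fun y => y.1.1)
      (AddMonoid.exponent_nsmul_eq_zero (⟨(g, h), hx⟩ : goursatSubgroup p q e)))
  · rw [AddMonoid.exponent_dvd_iff_forall_nsmul_eq_zero]
    rintro ⟨h, hh⟩
    obtain ⟨g, hx⟩ := exists_mem_goursatSubgroup_right e hh
    exact Subtype.ext (congrArg (fun y => y.1.2)
      (AddMonoid.exponent_nsmul_eq_zero (⟨(g, h), hx⟩ : goursatSubgroup p q e)))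

theorem exponent_quotient_dvd_iff {K : Type*} [AddCommGroup K] (A : AddSubgroup K) (n : ℕ) :
    AddMonoid.exponent (K ⧸ A) ∣ n ↔ ∀ x : K, n • x ∈ A := by
  rw [AddMonoid.exponent_dvd_iff_forall_nsmul_eq_zero,
    QuotientAddGroup.mk_surjective.forall]
  refine forall_congr' fun x => ?_
  rw [← QuotientAddGroup.mk_nsmul, QuotientAddGroup.eq_zero_iff]

/-- An integer kills the quotient iff it sends `G × 0` and `0 × H` into the subgroup, whose slices
there are `p.2` and `q.2`. -/
theorem exponent_quotient_goursatSubgroup (e : p.Subquotient ≃+ q.Subquotient) :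
    AddMonoid.exponent ((G × H) ⧸ goursatSubgroup p q e) =
      Nat.lcm (AddMonoid.exponent (G ⧸ p.2.map p.1.subtype))
        (AddMonoid.exponent (H ⧸ q.2.map q.1.subtype)) := by
  have hl : ∀ g : G, g ∈ p.2.map p.1.subtype ↔ (g, (0 : H)) ∈ goursatSubgroup p q e := by
    intro g
    constructor
    · rintro ⟨a, ha, rfl⟩
      exact (mem_left_kernel_iff_goursatSubgroup e).1 ha
    · intro h
      exact ⟨⟨g, (mem_goursatSubgroup.1 h).1⟩,
        (mem_left_kernel_iff_goursatSubgroup e (a := ⟨g, _⟩)).2 h, rfl⟩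
  have hr : ∀ h : H, h ∈ q.2.map q.1.subtype ↔ ((0 : G), h) ∈ goursatSubgroup p q e := by
    intro g
    constructor
    · rintro ⟨a, ha, rfl⟩
      exact (mem_right_kernel_iff_goursatSubgroup e).1 ha
    · intro h
      exact ⟨⟨g, (mem_goursatSubgroup.1 h).2.1⟩,
        (mem_right_kernel_iff_goursatSubgroup e (b := ⟨g, _⟩)).2 h, rfl⟩
  refine Nat.dvd_antisymm ?_ (Nat.lcm_dvd ?_ ?_)
  · rw [exponent_quotient_dvd_iff]
    rintro ⟨g, h⟩
    have h1 := (exponent_quotient_dvd_iff _ _).1 (Nat.dvd_lcm_left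
      (AddMonoid.exponent (G ⧸ p.2.map p.1.subtype))
        (AddMonoid.exponent (H ⧸ q.2.map q.1.subtype))) g
    have h2 := (exponent_quotient_dvd_iff _ _).1 (Nat.dvd_lcm_right
      (AddMonoid.exponent (G ⧸ p.2.map p.1.subtype))
        (AddMonoid.exponent (H ⧸ q.2.map q.1.subtype))) h
    simpa using add_mem ((hl _).1 h1) ((hr _).1 h2)
  · rw [exponent_quotient_dvd_iff]
    intro g
    rw [hl]
    simpa using (exponent_quotient_dvd_iff (goursatSubgroup p q e) _).1 dvd_rfl (g, 0)
  · rw [exponent_quotient_dvd_iff]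
    intro h
    rw [hr]
    simpa using (exponent_quotient_dvd_iff (goursatSubgroup p q e) _).1 dvd_rfl (0, h)

/-- The quintuple of orders and indices attached to two pairs of nested subgroups. -/
noncomputable def quintupleOf (p : SubPair G) (q : SubPair H) : Quintuple where
  c1 := Nat.card p.2
  c2 := p.1.index
  c3 := Nat.card p.Subquotient
  c4 := Nat.card q.2
  c5 := q.1.index

theorem SubPair.card_mul_card (p : SubPair G) :
    Nat.card p.2 * Nat.card p.Subquotient = Nat.card p.1 :=
  p.2.card_mul_index

theorem SubPair.card_mul_index_mul_card (p : SubPair G) :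
    Nat.card p.2 * p.1.index * Nat.card p.Subquotient = Nat.card G := by
  rw [mul_right_comm, p.card_mul_card, p.1.card_mul_index]

theorem SubPair.card_quotient_map [Finite G] (p : SubPair G) :
    Nat.card (G ⧸ p.2.map p.1.subtype) = Nat.card p.Subquotient * p.1.index := by
  have h1 := (p.2.map p.1.subtype).card_mul_index
  rw [← p.card_mul_index_mul_card, mul_assoc, mul_comm p.1.index] at h1
  have h2 : Nat.card (p.2.map p.1.subtype) = Nat.card p.2 :=
    (Nat.card_congr (p.2.equivMapOfInjective _ p.1.subtype_injective).toEquiv).symm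
  rw [h2] at h1
  exact Nat.eq_of_mul_eq_mul_left Nat.card_pos h1

variable [IsAddCyclic G] [IsAddCyclic H]

theorem exponent_goursatSubgroup_of_isAddCyclic (e : p.Subquotient ≃+ q.Subquotient) :
    AddMonoid.exponent (goursatSubgroup p q e) =
      (quintupleOf p q).c3 * Nat.lcm (quintupleOf p q).c1 (quintupleOf p q).c4 := by
  have he : Nat.card p.Subquotient = Nat.card q.Subquotient := Nat.card_congr e.toEquiv
  rw [exponent_goursatSubgroup, IsAddCyclic.exponent_eq_card, IsAddCyclic.exponent_eq_card,
    ← p.card_mul_card, ← q.card_mul_card, ← he, Nat.lcm_mul_right, mul_comm]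
  rfl

variable [Finite G] [Finite H]

/-- The order is `c₁c₃c₄` and the exponent `c₃ lcm(c₁,c₄)`; divide, using `gcd · lcm = c₁c₄`. -/
theorem cofactor_goursatSubgroup (e : p.Subquotient ≃+ q.Subquotient) :
    cofactor (goursatSubgroup p q e) = Nat.gcd (quintupleOf p q).c1 (quintupleOf p q).c4 := by
  have he : Nat.card p.Subquotient = Nat.card q.Subquotient := Nat.card_congr e.toEquiv
  have hpos : 0 < AddMonoid.exponent (goursatSubgroup p q e) :=
    Nat.pos_of_ne_zero AddMonoid.exponent_ne_zero_of_finite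
  have h := card_goursatSubgroup e
  rw [← p.card_mul_card, ← q.card_mul_card, ← mul_assoc] at h
  have h' := Nat.eq_of_mul_eq_mul_right Nat.card_pos h
  rw [cofactor, h']
  refine Nat.div_eq_of_eq_mul_left hpos ?_
  rw [exponent_goursatSubgroup_of_isAddCyclic, mul_left_comm, Nat.gcd_mul_lcm]
  simp only [quintupleOf]
  ring

theorem exponent_quotient_goursatSubgroup_of_isAddCyclic (e : p.Subquotient ≃+ q.Subquotient) :
    AddMonoid.exponent ((G × H) ⧸ goursatSubgroup p q e) =
      (quintupleOf p q).c3 * Nat.lcm (quintupleOf p q).c2 (quintupleOf p q).c5 := by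
  have he : Nat.card p.Subquotient = Nat.card q.Subquotient := Nat.card_congr e.toEquiv
  have hG : IsAddCyclic (G ⧸ p.2.map p.1.subtype) :=
    isAddCyclic_of_surjective _ (QuotientAddGroup.mk'_surjective (p.2.map p.1.subtype))
  have hH : IsAddCyclic (H ⧸ q.2.map q.1.subtype) :=
    isAddCyclic_of_surjective _ (QuotientAddGroup.mk'_surjective (q.2.map q.1.subtype))
  rw [exponent_quotient_goursatSubgroup, IsAddCyclic.exponent_eq_card,
    IsAddCyclic.exponent_eq_card, p.card_quotient_map, q.card_quotient_map, ← he,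
    Nat.lcm_mul_left]
  rfl

/-- The dual computation: the index is `c₂c₃c₅`. -/
theorem cofactor_quotient_goursatSubgroup (e : p.Subquotient ≃+ q.Subquotient) :
    cofactor ((G × H) ⧸ goursatSubgroup p q e) =
      Nat.gcd (quintupleOf p q).c2 (quintupleOf p q).c5 := by
  have he : Nat.card p.Subquotient = Nat.card q.Subquotient := Nat.card_congr e.toEquiv
  have hpos : 0 < AddMonoid.exponent ((G × H) ⧸ goursatSubgroup p q e) :=
    Nat.pos_of_ne_zero AddMonoid.exponent_ne_zero_of_finite
  have h := card_goursatSubgroup e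
  rw [← p.card_mul_card, ← q.card_mul_card, ← mul_assoc] at h
  have h' := Nat.eq_of_mul_eq_mul_right Nat.card_pos h
  have h2 := (goursatSubgroup p q e).card_mul_index
  rw [Nat.card_prod, ← p.card_mul_index_mul_card, ← q.card_mul_index_mul_card, h', ← he] at h2
  have hp2 : 0 < Nat.card p.2 := Nat.card_pos
  have hq2 : 0 < Nat.card q.2 := Nat.card_pos
  have hps : 0 < Nat.card p.Subquotient := Nat.card_pos
  have h3 : (goursatSubgroup p q e).index =
      p.1.index * Nat.card p.Subquotient * q.1.index := by
    refine Nat.eq_of_mul_eq_mul_left (Nat.mul_pos (Nat.mul_pos hp2 hps) hq2) (h2.trans ?_)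
    ring
  rw [cofactor]
  refine Nat.div_eq_of_eq_mul_left hpos ?_
  rw [exponent_quotient_goursatSubgroup_of_isAddCyclic, mul_left_comm, Nat.gcd_mul_lcm]
  refine Eq.trans h3 ?_
  simp only [quintupleOf]
  ring

end Goursat

/-! ### Sections of finite cyclic groups -/

/-- The order of `A` kills `A`, and a cyclic group has only that many elements killed by it. -/
theorem IsAddCyclic.eq_ker_nsmul {G : Type*} [AddCommGroup G] [Finite G] [IsAddCyclic G]
    (A : AddSubgroup G) : A = (nsmulAddMonoidHom (α := G) (Nat.card A)).ker := by
  refine AddSubgroup.eq_of_le_of_card_ge (fun x hx => ?_) ?_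
  · have := card_nsmul_eq_zero' (x := (⟨x, hx⟩ : A))
    exact congrArg Subtype.val this
  · rw [IsAddCyclic.card_nsmulAddMonoidHom_ker, Nat.gcd_eq_right A.card_addSubgroup_dvd_card]

theorem IsAddCyclic.addSubgroup_ext {G : Type*} [AddCommGroup G] [Finite G] [IsAddCyclic G]
    {A B : AddSubgroup G} (h : Nat.card A = Nat.card B) : A = B := by
  rw [IsAddCyclic.eq_ker_nsmul A, IsAddCyclic.eq_ker_nsmul B, h]

theorem IsAddCyclic.exists_addSubgroup_card {G : Type*} [AddCommGroup G] [Finite G]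
    [IsAddCyclic G] {d : ℕ} (hd : d ∣ Nat.card G) : ∃ A : AddSubgroup G, Nat.card A = d :=
  ⟨(nsmulAddMonoidHom (α := G) d).ker, by
    rw [IsAddCyclic.card_nsmulAddMonoidHom_ker, Nat.gcd_eq_right hd]⟩

theorem SubPair.ext_of_isAddCyclic {G : Type*} [AddCommGroup G] [Finite G] [IsAddCyclic G]
    {p q : SubPair G} (h1 : Nat.card p.2 = Nat.card q.2)
    (h2 : Nat.card p.Subquotient = Nat.card q.Subquotient) : p = q := by
  have h3 := p.card_mul_card
  rw [h1, h2, q.card_mul_card] at h3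
  obtain ⟨A, A₀⟩ := p
  obtain ⟨B, B₀⟩ := q
  obtain rfl : A = B := IsAddCyclic.addSubgroup_ext h3.symm
  obtain rfl : A₀ = B₀ := IsAddCyclic.addSubgroup_ext h1
  rfl

theorem SubPair.exists_of_isAddCyclic {G : Type*} [AddCommGroup G] [Finite G] [IsAddCyclic G]
    {a b c : ℕ} (h : a * b * c = Nat.card G) :
    ∃ p : SubPair G, Nat.card p.2 = a ∧ p.1.index = b ∧ Nat.card p.Subquotient = c := by
  have hpos : 0 < a * b * c := h ▸ Nat.card_pos
  have ha : 0 < a := Nat.pos_of_ne_zero (by rintro rfl; simp at hpos)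
  have hc : 0 < c := Nat.pos_of_ne_zero (by rintro rfl; simp at hpos)
  obtain ⟨A, hA⟩ := IsAddCyclic.exists_addSubgroup_card (G := G) (d := a * c)
    ⟨b, by rw [← h]; ring⟩
  obtain ⟨A₀, hA₀⟩ := IsAddCyclic.exists_addSubgroup_card (G := A) (d := a) (hA ▸ ⟨c, rfl⟩)
  refine ⟨⟨A, A₀⟩, hA₀, ?_, ?_⟩
  · refine Nat.eq_of_mul_eq_mul_left (Nat.mul_pos ha hc) ?_
    rw [← hA, A.card_mul_index, ← h, hA]
    ring
  · refine Nat.eq_of_mul_eq_mul_left ha ?_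
    rw [← hA, ← hA₀]
    exact SubPair.card_mul_card ⟨A, A₀⟩

theorem Nat.card_addEquiv_of_isAddCyclic {G H : Type*} [AddCommGroup G] [AddCommGroup H]
    [Finite G] [Finite H] [IsAddCyclic G] [IsAddCyclic H] :
    Nat.card (G ≃+ H) = if Nat.card G = Nat.card H then Nat.totient (Nat.card G) else 0 := by
  split_ifs with h
  · have hc := IsCyclic.card_mulAut (Multiplicative G)
    have hG : Nat.card (Multiplicative G) = Nat.card G := Nat.card_congr Multiplicative.toAdd
    rw [hG] at hc
    rw [← hc, ← Nat.card_congr (AddEquiv.toMultiplicative (G := G) (H := G))]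
    have e : G ≃+ H := addEquivOfAddCyclicCardEq h
    exact Nat.card_congr ⟨fun f => f.trans e.symm, fun f => AddEquiv.trans f e,
      fun f => by ext; simp, fun f => by ext; simp⟩
  · have : IsEmpty (G ≃+ H) := ⟨fun e => h (Nat.card_congr e.toEquiv)⟩
    exact Nat.card_of_isEmpty

/-! ### Sums over subgroups and sections of a product of two cyclic groups -/

/-- The quintuples with `c₁c₂c₃ = m` and `c₃c₄c₅ = n`, empty when `m` or `n` vanishes. -/
def quintuples (m n : ℕ) : Finset Quintuple :=
  ((m.divisors ×ˢ m.divisors ×ˢ m.divisors ×ˢ n.divisors ×ˢ n.divisors).filter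
    fun c => c.1 * c.2.1 * c.2.2.1 = m ∧ c.2.2.1 * c.2.2.2.1 * c.2.2.2.2 = n).map
  ⟨fun c => ⟨c.1, c.2.1, c.2.2.1, c.2.2.2.1, c.2.2.2.2⟩, by
    rintro ⟨a, b, c, d, e⟩ ⟨a', b', c', d', e'⟩ h
    simpa using h⟩

theorem mem_quintuples {m n : ℕ} {x : Quintuple} : x ∈ quintuples m n ↔
    m ≠ 0 ∧ n ≠ 0 ∧ x.c1 * x.c2 * x.c3 = m ∧ x.c3 * x.c4 * x.c5 = n := by
  simp only [quintuples, Finset.mem_map, Finset.mem_filter, Finset.mem_product,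
    Nat.mem_divisors]
  constructor
  · rintro ⟨c, h, rfl⟩
    exact ⟨h.1.1.2, h.1.2.2.2.1.2, h.2⟩
  · rintro ⟨hm, hn, h1, h2⟩
    refine ⟨(x.c1, x.c2, x.c3, x.c4, x.c5),
      ⟨⟨⟨⟨x.c2 * x.c3, ?_⟩, hm⟩, ⟨⟨x.c1 * x.c3, ?_⟩, hm⟩, ⟨⟨x.c1 * x.c2, ?_⟩, hm⟩,
        ⟨⟨x.c3 * x.c5, ?_⟩, hn⟩, ⟨⟨x.c3 * x.c4, ?_⟩, hn⟩⟩, h1, h2⟩, rfl⟩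
    · rw [← h1]; ring
    · rw [← h1]; ring
    · rw [← h1]; ring
    · rw [← h2]; ring
    · rw [← h2]; ring

theorem pos_of_mem_quintuples {m n : ℕ} {x : Quintuple} (h : x ∈ quintuples m n) : x.Pos := by
  obtain ⟨hm, hn, rfl, rfl⟩ := mem_quintuples.1 h
  simp only [ne_eq, mul_eq_zero, not_or] at hm hn
  simp only [Quintuple.Pos, Nat.pos_iff_ne_zero]
  tauto

/-- Group the subgroups by their pair of sections. The summand ignores the isomorphism, so each
admissible pair, equivalently each quintuple, has weight `φ(c₃)`. -/
theorem finsum_addSubgroup_prod {G H : Type*} [AddCommGroup G] [AddCommGroup H] [Finite G]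
    [Finite H] [IsAddCyclic G] [IsAddCyclic H] (g : AddSubgroup (G × H) → ℕ) (f : Quintuple → ℕ)
    (hgf : ∀ p q e, g (goursatSubgroup p q e) = f (quintupleOf p q)) :
    ∑ᶠ I, g I = ∑ x ∈ quintuples (Nat.card G) (Nat.card H), Nat.totient x.c3 * f x := by
  classical
  have := Fintype.ofFinite (AddSubgroup (G × H))
  have := Fintype.ofFinite (SubPair G)
  have := Fintype.ofFinite (SubPair H)
  have (pq : SubPair G × SubPair H) : Finite (pq.1.Subquotient ≃+ pq.2.Subquotient) :=
    DFunLike.finite _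
  have (pq : SubPair G × SubPair H) := Fintype.ofFinite (pq.1.Subquotient ≃+ pq.2.Subquotient)
  have hcyc (A : AddSubgroup G) (A₀ : AddSubgroup A) : IsAddCyclic (A ⧸ A₀) :=
    isAddCyclic_of_surjective _ (QuotientAddGroup.mk'_surjective A₀)
  have hcyc' (A : AddSubgroup H) (A₀ : AddSubgroup A) : IsAddCyclic (A ⧸ A₀) :=
    isAddCyclic_of_surjective _ (QuotientAddGroup.mk'_surjective A₀)
  rw [finsum_eq_sum_of_fintype,
    ← (goursatSubgroup_bijective (G := G) (H := H)).sum_comp g, Fintype.sum_sigma]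
  have h1 (pq : SubPair G × SubPair H) :
      ∑ e : (pq.1.Subquotient ≃+ pq.2.Subquotient), g (goursatSubgroup pq.1 pq.2 e) =
      if Nat.card pq.1.Subquotient = Nat.card pq.2.Subquotient then
        Nat.totient (quintupleOf pq.1 pq.2).c3 * f (quintupleOf pq.1 pq.2) else 0 := by
    simp only [hgf, Finset.sum_const, Finset.card_univ, ← Nat.card_eq_fintype_card,
      Nat.card_addEquiv_of_isAddCyclic, smul_eq_mul, ite_mul, zero_mul]
    rfl
  rw [Finset.sum_congr rfl fun pq _ => h1 pq, ← Finset.sum_filter]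
  refine Finset.sum_bij (fun pq _ => quintupleOf pq.1 pq.2) ?_ ?_ ?_ ?_
  · rintro ⟨p, q⟩ h
    rw [Finset.mem_filter] at h
    refine mem_quintuples.2 ⟨Nat.card_pos.ne', Nat.card_pos.ne', p.card_mul_index_mul_card, ?_⟩
    rw [← q.card_mul_index_mul_card]
    change Nat.card p.Subquotient * _ * _ = _
    rw [h.2, mul_assoc, mul_comm]
    rfl
  · rintro ⟨p, q⟩ h ⟨p', q'⟩ h' he
    rw [Finset.mem_filter] at h h'
    have e1 := congrArg Quintuple.c1 he
    have e3 := congrArg Quintuple.c3 he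
    have e4 := congrArg Quintuple.c4 he
    -- The indices `c₂`, `c₅` are redundant here; `c₃` is the common order of both subquotients.
    have hp : p = p' := SubPair.ext_of_isAddCyclic e1 e3
    have hq : q = q' := SubPair.ext_of_isAddCyclic e4 (h.2.symm.trans (e3.trans h'.2))
    rw [hp, hq]
  · intro x hx
    obtain ⟨-, -, h1, h2⟩ := mem_quintuples.1 hx
    obtain ⟨p, p1, p2, p3⟩ := SubPair.exists_of_isAddCyclic h1
    obtain ⟨q, q1, q2, q3⟩ := SubPair.exists_of_isAddCyclic
      (a := x.c4) (b := x.c5) (c := x.c3) (G := H) (by rw [← h2]; ring)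
    exact ⟨(p, q), by simp [p3, q3], Quintuple.ext p1 p2 p3 q1 q2⟩
  · intros
    rfl

theorem cofactor_congr {G H : Type*} [AddCommGroup G] [AddCommGroup H] (e : G ≃+ H) :
    cofactor G = cofactor H := by
  rw [cofactor, cofactor, Nat.card_congr e.toEquiv, AddMonoid.exponent_eq_of_addEquiv e]

theorem finsum_quotient_congr {G H : Type*} [AddCommGroup G] [AddCommGroup H] (e : G ≃+ H)
    (F : ℕ → ℕ → ℕ) :
    ∑ᶠ K : AddSubgroup G, F (cofactor (G ⧸ K)) (AddMonoid.exponent (G ⧸ K)) =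
      ∑ᶠ K : AddSubgroup H, F (cofactor (H ⧸ K)) (AddMonoid.exponent (H ⧸ K)) := by
  rw [← finsum_comp_equiv e.mapAddSubgroup.toEquiv]
  refine finsum_congr fun K => ?_
  have e' : (G ⧸ K) ≃+ (H ⧸ e.mapAddSubgroup.toEquiv K) :=
    QuotientAddGroup.congr K (e.mapAddSubgroup.toEquiv K) e rfl
  rw [cofactor_congr e', AddMonoid.exponent_eq_of_addEquiv e']

/-- Pairs of quintuples that describe the pairs of nested subgroups of `ℤ_m × ℤ_n`. -/
def nestedQuintuples (m n : ℕ) : Finset (Σ _ : Quintuple, Quintuple) :=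
  (quintuples m n).sigma fun x =>
    quintuples (Nat.gcd x.c1 x.c4) (x.c3 * Nat.lcm x.c1 x.c4)

theorem finsum_quotient_zmod_prod (m n : ℕ) [NeZero m] [NeZero n] (F : ℕ → ℕ → ℕ) :
    ∑ᶠ K : AddSubgroup (ZMod m × ZMod n),
      F (cofactor ((ZMod m × ZMod n) ⧸ K)) (AddMonoid.exponent ((ZMod m × ZMod n) ⧸ K)) =
    ∑ x ∈ quintuples m n, Nat.totient x.c3 *
      F (Nat.gcd x.c2 x.c5) (x.c3 * Nat.lcm x.c2 x.c5) := by
  have := finsum_addSubgroup_prod (G := ZMod m) (H := ZMod n)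
    (fun K => F (cofactor ((ZMod m × ZMod n) ⧸ K)) (AddMonoid.exponent ((ZMod m × ZMod n) ⧸ K)))
    (fun x => F (Nat.gcd x.c2 x.c5) (x.c3 * Nat.lcm x.c2 x.c5)) (fun p q e => by
      simp only [cofactor_quotient_goursatSubgroup,
        exponent_quotient_goursatSubgroup_of_isAddCyclic])
  rwa [Nat.card_zmod, Nat.card_zmod] at this

/-- Goursat is used twice: for the subgroup `I`, then for `K ≤ I` after `I` is replaced by its
normal form. The weight `F` is arbitrary so that it can later carry the test for equal invariants.
-/
theorem finsum_subPair_zmod_prod (m n : ℕ) [NeZero m] [NeZero n] (F : ℕ → ℕ → ℕ) :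
    ∑ᶠ p : SubPair (ZMod m × ZMod n),
      F (cofactor p.Subquotient) (AddMonoid.exponent p.Subquotient) =
    ∑ w ∈ nestedQuintuples m n, Nat.totient w.1.c3 * Nat.totient w.2.c3 *
      F (Nat.gcd w.2.c2 w.2.c5) (w.2.c3 * Nat.lcm w.2.c2 w.2.c5) := by
  have hs : ∑ᶠ p : SubPair (ZMod m × ZMod n),
      F (cofactor p.Subquotient) (AddMonoid.exponent p.Subquotient) =
      ∑ᶠ I : AddSubgroup (ZMod m × ZMod n), ∑ᶠ K : AddSubgroup I,
        F (cofactor (I ⧸ K)) (AddMonoid.exponent (I ⧸ K)) := by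
    have := Fintype.ofFinite (AddSubgroup (ZMod m × ZMod n))
    have (I : AddSubgroup (ZMod m × ZMod n)) := Fintype.ofFinite (AddSubgroup I)
    simp only [finsum_eq_sum_of_fintype]
    exact Fintype.sum_sigma _
  rw [hs, finsum_addSubgroup_prod _ (fun x =>
    ∑ y ∈ quintuples (Nat.gcd x.c1 x.c4) (x.c3 * Nat.lcm x.c1 x.c4), Nat.totient y.c3 *
      F (Nat.gcd y.c2 y.c5) (y.c3 * Nat.lcm y.c2 y.c5)), Nat.card_zmod, Nat.card_zmod,
    nestedQuintuples, Finset.sum_sigma]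
  · simp only [Finset.mul_sum, mul_assoc]
  · intro p q e
    have ht : TorsionLeSq (goursatSubgroup p q e) :=
      TorsionLeSq.prod.of_injective _ (goursatSubgroup p q e).subtype_injective
    obtain ⟨e'⟩ := ht.nonempty_addEquiv
    -- The moduli of the normal form must be nonzero, since `ZMod 0` is infinite.
    have : NeZero (cofactor (goursatSubgroup p q e)) := by
      refine ⟨?_⟩
      rw [cofactor_goursatSubgroup]
      exact (Nat.gcd_pos_of_pos_left _ Nat.card_pos).ne'
    have : NeZero (AddMonoid.exponent (goursatSubgroup p q e)) :=
      ⟨AddMonoid.exponent_ne_zero_of_finite⟩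
    rw [finsum_quotient_congr e', finsum_quotient_zmod_prod, cofactor_goursatSubgroup,
      exponent_goursatSubgroup_of_isAddCyclic]

/-! ### Four cyclic factors -/

/-- Equal invariants give a common normal form, and conjugation turns isomorphisms into its
automorphisms; invariants that differ exclude any isomorphism. -/
theorem TorsionLeSq.card_addEquiv {G H : Type*} [AddCommGroup G] [AddCommGroup H] [Finite G]
    [Finite H] (hG : TorsionLeSq G) (hH : TorsionLeSq H) :
    Nat.card (G ≃+ H) =
      if cofactor G = cofactor H ∧ AddMonoid.exponent G = AddMonoid.exponent H then
        numAut (cofactor G) (AddMonoid.exponent G) else 0 := by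
  split_ifs with h
  · obtain ⟨e⟩ := hG.nonempty_addEquiv
    obtain ⟨e'⟩ := hH.nonempty_addEquiv
    rw [← h.1, ← h.2] at e'
    exact Nat.card_congr ⟨fun f => e.symm.trans (f.trans e'), fun f => e.trans (f.trans e'.symm),
      fun f => by ext; simp, fun f => by ext <;> simp⟩
  · have : IsEmpty (G ≃+ H) :=
      ⟨fun e => h ⟨cofactor_congr e, AddMonoid.exponent_eq_of_addEquiv e⟩⟩
    exact Nat.card_of_isEmpty

theorem numSubgroups_eq_sum (m n r s : ℕ) [NeZero m] [NeZero n] [NeZero r] [NeZero s] :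
    numSubgroups m n r s = ∑ w ∈ nestedQuintuples m n, ∑ w' ∈ nestedQuintuples r s,
      if Nat.gcd w.2.c2 w.2.c5 = Nat.gcd w'.2.c2 w'.2.c5 ∧
        w.2.c3 * Nat.lcm w.2.c2 w.2.c5 = w'.2.c3 * Nat.lcm w'.2.c2 w'.2.c5 then
        Nat.totient w.1.c3 * Nat.totient w.2.c3 * Nat.totient w'.1.c3 * Nat.totient w'.2.c3 *
          numAut (Nat.gcd w.2.c2 w.2.c5) (w.2.c3 * Nat.lcm w.2.c2 w.2.c5) else 0 := by
  have e : (ZMod m × ZMod n × ZMod r × ZMod s) ≃+ (ZMod m × ZMod n) × (ZMod r × ZMod s) :=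
    AddEquiv.prodAssoc.symm
  have := Fintype.ofFinite (SubPair (ZMod m × ZMod n))
  have := Fintype.ofFinite (SubPair (ZMod r × ZMod s))
  have (pq : SubPair (ZMod m × ZMod n) × SubPair (ZMod r × ZMod s)) :
    Finite (pq.1.Subquotient ≃+ pq.2.Subquotient) := DFunLike.finite _
  have ht (k l : ℕ) [NeZero k] [NeZero l] (p : SubPair (ZMod k × ZMod l)) :
      TorsionLeSq p.Subquotient :=
    (TorsionLeSq.prod.of_injective _ p.1.subtype_injective).of_surjective _
      (QuotientAddGroup.mk'_surjective p.2)
  have hN : numSubgroups m n r s = ∑ᶠ p : SubPair (ZMod m × ZMod n),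
      ∑ᶠ q : SubPair (ZMod r × ZMod s),
        if cofactor p.Subquotient = cofactor q.Subquotient ∧
            AddMonoid.exponent p.Subquotient = AddMonoid.exponent q.Subquotient then
          numAut (cofactor p.Subquotient) (AddMonoid.exponent p.Subquotient) else 0 := by
    rw [numSubgroups, Nat.card_congr e.mapAddSubgroup.toEquiv,
      ← Nat.card_congr (Equiv.ofBijective _ goursatSubgroup_bijective), Nat.card_sigma,
      Fintype.sum_prod_type]
    simp only [finsum_eq_sum_of_fintype, (ht _ _ _).card_addEquiv (ht _ _ _)]
  rw [hN]
  -- For a fixed section on the left with invariants `u`, `v`, the sum over right sections has a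
  -- weight depending only on their invariants. The result depends only on `u`, `v`, so the left sum
  -- is of the same kind.
  have hinner (u v : ℕ) := finsum_subPair_zmod_prod r s
    (fun a b => if u = a ∧ v = b then numAut u v else 0)
  simp only [hinner]
  rw [finsum_subPair_zmod_prod m n (fun u v => ∑ w ∈ nestedQuintuples r s,
    Nat.totient w.1.c3 * Nat.totient w.2.c3 * if u = Nat.gcd w.2.c2 w.2.c5 ∧
      v = w.2.c3 * Nat.lcm w.2.c2 w.2.c5 then numAut u v else 0)]
  refine Finset.sum_congr rfl fun w _ => ?_
  rw [Finset.mul_sum]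
  refine Finset.sum_congr rfl fun w' _ => ?_
  split_ifs
  · ring
  · simp

/-- The 20-tuples of the index set, as a finite set. -/
def indexFinset (m n r s : ℕ) : Finset Tuple20 :=
  ((nestedQuintuples m n ×ˢ nestedQuintuples r s).filter fun w =>
    Nat.gcd w.1.2.c2 w.1.2.c5 = Nat.gcd w.2.2.c2 w.2.2.c5 ∧
      w.1.2.c3 * Nat.lcm w.1.2.c2 w.1.2.c5 = w.2.2.c3 * Nat.lcm w.2.2.c2 w.2.2.c5).map
  ⟨fun w => ⟨w.1.1, w.1.2, w.2.1, w.2.2⟩, by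
    rintro ⟨⟨a, b⟩, ⟨c, d⟩⟩ ⟨⟨a', b'⟩, ⟨c', d'⟩⟩ h
    simp only [Tuple20.mk.injEq] at h
    obtain ⟨rfl, rfl, rfl, rfl⟩ := h
    rfl⟩

theorem mem_nestedQuintuples {m n : ℕ} (hm : m ≠ 0) (hn : n ≠ 0)
    {w : Σ _ : Quintuple, Quintuple} :
    w ∈ nestedQuintuples m n ↔ w.1.Pos ∧ w.2.Pos ∧
      w.1.c1 * w.1.c2 * w.1.c3 = m ∧ w.1.c3 * w.1.c4 * w.1.c5 = n ∧
      w.2.c1 * w.2.c2 * w.2.c3 = Nat.gcd w.1.c1 w.1.c4 ∧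
      w.2.c3 * w.2.c4 * w.2.c5 = w.1.c3 * Nat.lcm w.1.c1 w.1.c4 := by
  rw [nestedQuintuples, Finset.mem_sigma]
  constructor
  · rintro ⟨h1, h2⟩
    have h3 := mem_quintuples.1 h1
    have h4 := mem_quintuples.1 h2
    exact ⟨pos_of_mem_quintuples h1, pos_of_mem_quintuples h2, h3.2.2.1, h3.2.2.2, h4.2.2⟩
  · rintro ⟨h1, h2, h3, h4, h5⟩
    exact ⟨mem_quintuples.2 ⟨hm, hn, h3, h4⟩, mem_quintuples.2
      ⟨(Nat.gcd_pos_of_pos_left _ h1.1).ne',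
        (Nat.mul_pos h1.2.2.1 (Nat.lcm_pos h1.1 h1.2.2.2.1)).ne', h5⟩⟩

theorem coe_indexFinset {m n r s : ℕ} (hm : m ≠ 0) (hn : n ≠ 0) (hr : r ≠ 0) (hs : s ≠ 0) :
    (indexFinset m n r s : Set Tuple20) = indexSet m n r s := by
  ext q
  simp only [indexFinset, Finset.coe_map, Finset.coe_filter, Finset.mem_product,
    mem_nestedQuintuples hm hn, mem_nestedQuintuples hr hs,
    Set.mem_image, Set.mem_ofPred_eq, indexSet]
  constructor
  · rintro ⟨w, h, rfl⟩
    tauto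
  · intro h
    exact ⟨(⟨q.x, q.y⟩, ⟨q.z, q.t⟩), by tauto, rfl⟩

theorem mainTheorem1 (m n r s : ℕ) (hm : 0 < m) (hn : 0 < n) (hr : 0 < r) (hs : 0 < s) :
    (indexSet m n r s).Finite ∧
    numSubgroups m n r s =
      ∑ᶠ q ∈ indexSet m n r s,
        Nat.totient q.x.c3 * Nat.totient q.y.c3 * Nat.totient q.z.c3 * Nat.totient q.t.c3 *
          numAut (Nat.gcd q.y.c2 q.y.c5) (q.y.c3 * Nat.lcm q.y.c2 q.y.c5) := by
  have : NeZero m := ⟨hm.ne'⟩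
  have : NeZero n := ⟨hn.ne'⟩
  have : NeZero r := ⟨hr.ne'⟩
  have : NeZero s := ⟨hs.ne'⟩
  rw [← coe_indexFinset hm.ne' hn.ne' hr.ne' hs.ne']
  refine ⟨Finset.finite_toSet _, ?_⟩
  rw [finsum_mem_coe_finset, numSubgroups_eq_sum, indexFinset, Finset.sum_map, Finset.sum_filter,
    Finset.sum_product]
  refine Finset.sum_congr rfl fun w _ => Finset.sum_congr rfl fun w' _ => ?_
  rfl
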